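/- Let $\|\cdot\|$ be the Euclidean norm on $\mathbb{C}^n$ and the induced operator norm (matrix two-norm) on $\mathbb{C}^{n\times n}$. For $A\in\mathbb{C}^{n\times n}$ let $L_{\exp}(A,\cdot)$ denote the Fréchet derivative of the matrix exponential at $A$. For $y,z\in\mathbb{C}^n$ and $m\ge 1$, let $V_m$ and $W_m$ be the matrices whose columns are the orthonormal bases of the Krylov spaces $\mathcal K_m(A,y)=\mathrm{span}\{y,Ay,\dots,A^{m-1}y\}$ and $\mathcal K_m(A^H,z)$ computed by $m$ steps of the Arnoldi process, and let $G_m$, $H_m$ be the corresponding upper Hessenberg matrices of orthonormalization coefficients. (If an Arnoldi process terminates early, the vectors computed up to then are used; for a zero starting vector the basis is empty and the approximation below is $0$.) For an entire function $f$, the $m$-th Arnoldi approximation of $L_f(A,yz^H)$ is $$L_m^{\mathrm{Arn}} = V_m\left(\frac{1}{2\pi i}\int_\Gamma f(\zeta)\,\|y\|\,\|z\|\,(\zeta I-G_m)^{-1}e_1e_1^H(\zeta I-H_m^H)^{-1}\,d\zeta\right)W_m^H ,$$ where $\Gamma$ is a positively oriented circle whose interior contains the spectrum of $A$. **Theorem.**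 Let $\rho>0$ and $t>0$, and let $A\in\mathbb{C}^{n\times n}$ be Hermitian negative semidefinite with spectrum contained in $[-4\rho,0]$. Let $y,z\in\mathbb{C}^n$, let $L_m^{\mathrm{Arn}}$ be the $m$-th Arnoldi approximation of $L_{\exp}(tA,yz^H)$ (that is, the above construction with $f=\exp$ and $tA$ in place of $A$), and let $\varepsilon_m=\|L_{\exp}(tA,yz^H)-L_m^{\mathrm{Arn}}\|$. Then $$\varepsilon_m\le 10\,\frac{(4\rho t)^2}{m^2}\,e^{-m^2/(5\rho t)}\,\|y\|\,\|z\|\qquad\text{if } \sqrt{4\rho t}\le m\le 2\rho t,$$ $$\varepsilon_m\le \frac{40}{\rho t}\,e^{-\rho t}\left(\frac{e\rho t}{m}\right)^m\|y\|\,\|z\|\qquad\text{if } m\ge 2\rho t.$$ -/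

import Mathlib

open scoped Matrix.Norms.L2Operator

noncomputable section

/-- The Arnoldi vectors `v₁, v₂, …` of `A` and the starting vector `b` (numbered from `0`):
`v₁ = b / ‖b‖`, and `vⱼ₊₁` is the normalization of `A vⱼ - ∑ i ≤ j, (vᵢᴴ A vⱼ) vᵢ`.
If the vector to be normalized vanishes (the process terminates), this vector and all later ones
are `0`. -/
def arnoldiVec {n : ℕ} (A : Matrix (Fin n) (Fin n) ℂ) (b : EuclideanSpace ℂ (Fin n)) :
    ℕ → EuclideanSpace ℂ (Fin n)
  | 0 => (‖b‖ : ℂ)⁻¹ • b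
  | j + 1 =>
    let w := Matrix.toEuclideanLin A (arnoldiVec A b j) -
      ∑ i : Fin (j + 1),
        inner ℂ (arnoldiVec A b i) (Matrix.toEuclideanLin A (arnoldiVec A b j)) •
          arnoldiVec A b i
    (‖w‖ : ℂ)⁻¹ • w
termination_by j => j
decreasing_by all_goals omega

/-- The norm of the `j`-th Arnoldi residual before normalization, that is, the subdiagonal
coefficient in row `j + 1` and column `j` of the Hessenberg matrix. -/
def arnoldiSub {n : ℕ} (A : Matrix (Fin n) (Fin n) ℂ) (b : EuclideanSpace ℂ (Fin n))
    (j : ℕ) : ℝ :=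
  ‖Matrix.toEuclideanLin A (arnoldiVec A b j) -
      ∑ i : Fin (j + 1),
        inner ℂ (arnoldiVec A b i) (Matrix.toEuclideanLin A (arnoldiVec A b j)) •
          arnoldiVec A b i‖

/-- The indices of the basis vectors produced by `m` Arnoldi steps. These are all of
`0, …, m - 1`, unless the process terminates earlier; then they are the steps before
termination, whose vectors already span an invariant subspace. -/
abbrev ArnoldiIndex {n : ℕ} (A : Matrix (Fin n) (Fin n) ℂ) (b : EuclideanSpace ℂ (Fin n))
    (m : ℕ) : Type :=
  {j : Fin m // arnoldiVec A b j ≠ 0}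

instance {n : ℕ} (A : Matrix (Fin n) (Fin n) ℂ) (b : EuclideanSpace ℂ (Fin n)) (m : ℕ) :
    Fintype (ArnoldiIndex A b m) :=
  Fintype.ofFinite _

/-- The matrix `V_m` whose columns are the orthonormal Arnoldi basis of the Krylov space
`span {b, A b, …, A ^ (m - 1) b}`. -/
def arnoldiBasis {n : ℕ} (A : Matrix (Fin n) (Fin n) ℂ) (b : EuclideanSpace ℂ (Fin n))
    (m : ℕ) : Matrix (Fin n) (ArnoldiIndex A b m) ℂ :=
  Matrix.of fun i j => arnoldiVec A b j.1 i

/-- The upper Hessenberg matrix of the orthonormalization coefficients of `m` Arnoldi steps. -/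
def arnoldiHess {n : ℕ} (A : Matrix (Fin n) (Fin n) ℂ) (b : EuclideanSpace ℂ (Fin n))
    (m : ℕ) : Matrix (ArnoldiIndex A b m) (ArnoldiIndex A b m) ℂ :=
  Matrix.of fun i j =>
    if (i.1 : ℕ) ≤ j.1 then
      inner ℂ (arnoldiVec A b i.1) (Matrix.toEuclideanLin A (arnoldiVec A b j.1))
    else if (i.1 : ℕ) = j.1 + 1 then (arnoldiSub A b j.1 : ℂ)
    else 0

/-- The first canonical unit vector. -/
def arnoldiE1 {n : ℕ} (A : Matrix (Fin n) (Fin n) ℂ) (b : EuclideanSpace ℂ (Fin n))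
    (m : ℕ) : ArnoldiIndex A b m → ℂ :=
  fun j => if (j.1 : ℕ) = 0 then 1 else 0

/-- The matrix
`X_m = (2πi)⁻¹ ∮ f(ζ) ‖y‖ ‖z‖ (ζ I - G_m)⁻¹ e₁ e₁ᴴ (ζ I - H_mᴴ)⁻¹ dζ`
over the positively oriented circle with centre `c` and radius `R` (an entrywise integral), where
`G_m` and `H_m` are the Hessenberg matrices of `m` Arnoldi steps for `A, y` and for `Aᴴ, z`. -/
def arnoldiCore {n : ℕ} (f : ℂ → ℂ) (A : Matrix (Fin n) (Fin n) ℂ)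
    (y z : EuclideanSpace ℂ (Fin n)) (m : ℕ) (c : ℂ) (R : ℝ) :
    Matrix (ArnoldiIndex A y m) (ArnoldiIndex A.conjTranspose z m) ℂ :=
  Matrix.of fun i j => (2 * Real.pi * Complex.I : ℂ)⁻¹ *
    ∮ ζ in C(c, R), f ζ * ((‖y‖ : ℂ) * (‖z‖ : ℂ)) *
      ((ζ • (1 : Matrix (ArnoldiIndex A y m) (ArnoldiIndex A y m) ℂ) - arnoldiHess A y m)⁻¹ *
        Matrix.vecMulVec (arnoldiE1 A y m) (star (arnoldiE1 A.conjTranspose z m)) *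
        (ζ • (1 : Matrix (ArnoldiIndex A.conjTranspose z m)
            (ArnoldiIndex A.conjTranspose z m) ℂ) -
          (arnoldiHess A.conjTranspose z m).conjTranspose)⁻¹) i j

/-- The `m`-th Arnoldi approximation `L_m = V_m X_m W_mᴴ` of the Fréchet derivative
`L_f(A, y zᴴ)`, formed with the circle of centre `c` and radius `R` as integration contour. -/
def arnoldiFrechet {n : ℕ} (f : ℂ → ℂ) (A : Matrix (Fin n) (Fin n) ℂ)
    (y z : EuclideanSpace ℂ (Fin n)) (m : ℕ) (c : ℂ) (R : ℝ) : Matrix (Fin n) (Fin n) ℂ :=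
  arnoldiBasis A y m * arnoldiCore f A y z m c R *
    (arnoldiBasis A.conjTranspose z m).conjTranspose

/-- The Fréchet derivative `L_exp(A, E)` of the matrix exponential at `A` in the direction `E`. -/
def expFrechet {n : ℕ} (A E : Matrix (Fin n) (Fin n) ℂ) : Matrix (Fin n) (Fin n) ℂ :=
  fderiv ℂ (fun X : Matrix (Fin n) (Fin n) ℂ => NormedSpace.exp X) A E

/-- The matrix exponential is Fréchet differentiable everywhere, so that `expFrechet` is its
derivative. -/
theorem differentiableAt_matrix_exp {n : ℕ} (A : Matrix (Fin n) (Fin n) ℂ) :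
    DifferentiableAt ℂ (fun X : Matrix (Fin n) (Fin n) ℂ => NormedSpace.exp X) A :=
  (NormedSpace.exp_analytic (𝕂 := ℂ) A).differentiableAt

end

/-! Put S = tA. In an eigenbasis of S, the map L_exp(S, ·) multiplies the (k, l) entry by the
divided difference exp[λ_k, λ_l] (`fderiv_exp_eq_bivariateFun`). By Cauchy's formula, the Arnoldi
core is the same bivariate function of the compressed Hermitian matrices G_m and H_mᴴ
(`arnoldiCore_eq_bivariateFun`). Let p have degree < m and antiderivative Q. The divided difference
of Q combines monomials x^i y^j with i + j < m, on which the approximation is exact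
(`arnoldi_exact`), so it may be subtracted from both sides. What remains is the divided difference
of exp - Q, bounded by E = max |exp - p| on the spectral interval by the mean value inequality.
Compression keeps eigenvalues in that interval, and the direction has rank one, so each side
contributes at most E‖y‖‖z‖. With a = 2ρt, Chebyshev truncation gives E = 4 exp(a(cosh σ - 1) - mσ)
for every real σ. The two regimes come from σ = m/a and σ = log(2m/a). -/

/-! ### Chebyshev approximation of the exponential -/

open Polynomial in
/-- Powers of `2X` are sums of Chebyshev polynomials of the first kind. -/
theorem exists_multiset_two_mul_X_pow (k : ℕ) :
    ∃ s : Multiset ℤ, ((2 : ℝ[X]) * X) ^ k = (s.map (Chebyshev.T ℝ)).sum := by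
  induction k with
  | zero => exact ⟨{0}, by simp⟩
  | succ k ih =>
    obtain ⟨s, hs⟩ := ih
    -- 2X T_l = T_{l+1} + T_{l-1}; integer indices avoid a special case at l = 0.
    refine ⟨s.map (· + 1) + s.map (· - 1), ?_⟩
    rw [pow_succ', hs, Multiset.map_add, Multiset.sum_add, Multiset.map_map, Multiset.map_map,
      ← Multiset.sum_map_mul_left, ← Multiset.sum_map_add]
    congr 1
    refine Multiset.map_congr rfl fun l _ => ?_
    have := Chebyshev.T_add_two ℝ (l - 1)
    rw [show l - 1 + 2 = l + 1 by ring, show l - 1 + 1 = l by ring] at this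
    simp only [Function.comp_apply]
    rw [this]; ring

open Polynomial in
/-- Truncating the Chebyshev expansion of `x ^ k`. -/
theorem exists_poly_approx_pow (m k : ℕ) (σ : ℝ) :
    ∃ q ∈ degreeLT ℝ m, ∀ x : ℝ, |x| ≤ 1 →
      |x ^ k - q.eval x| ≤ Real.cosh σ ^ k / Real.cosh (m * σ) := by
  obtain ⟨s, hs⟩ := exists_multiset_two_mul_X_pow k
  set s₁ := s.filter fun l => l.natAbs < m
  set s₂ := s.filter fun l => ¬ l.natAbs < m
  have hs₁₂ : s₁ + s₂ = s := Multiset.filter_add_not _ s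
  have hev (x : ℝ) : (2 * x) ^ k = (s₁.map fun l => (Chebyshev.T ℝ l).eval x).sum +
      (s₂.map fun l => (Chebyshev.T ℝ l).eval x).sum := by
    have := congrArg (eval x) hs
    rw [← Multiset.sum_add, ← Multiset.map_add, hs₁₂]
    rw [← coe_evalRingHom, map_multiset_sum, Multiset.map_map] at this
    simpa using this
  -- A Chernoff-type count of the discarded terms: at cosh σ each T_l equals cosh(lσ), so kept terms
  -- are positive and discarded ones are at least cosh(mσ).
  have hcard : (Multiset.card s₂ : ℝ) * Real.cosh (m * σ) ≤ (2 * Real.cosh σ) ^ k := by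
    rw [hev]
    have h1 : 0 ≤ (s₁.map fun l => (Chebyshev.T ℝ l).eval (Real.cosh σ)).sum := by
      refine Multiset.sum_nonneg fun y hy => ?_
      obtain ⟨l, -, rfl⟩ := Multiset.mem_map.1 hy
      rw [Chebyshev.T_real_cosh]
      exact (Real.cosh_pos _).le
    have h2 : Multiset.card s₂ • Real.cosh (m * σ) ≤
        (s₂.map fun l => (Chebyshev.T ℝ l).eval (Real.cosh σ)).sum := by
      rw [← Multiset.card_map (fun l => (Chebyshev.T ℝ l).eval (Real.cosh σ)) s₂]
      refine Multiset.card_nsmul_le_sum fun y hy => ?_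
      obtain ⟨l, hl, rfl⟩ := Multiset.mem_map.1 hy
      rw [Chebyshev.T_real_cosh, Real.cosh_le_cosh, abs_mul, abs_mul]
      have hl : m ≤ l.natAbs := not_lt.1 (Multiset.mem_filter.1 hl).2
      refine mul_le_mul_of_nonneg_right ?_ (abs_nonneg _)
      rw [← Int.cast_abs, Int.abs_eq_natAbs, Nat.abs_cast]
      exact_mod_cast hl
    rw [nsmul_eq_mul] at h2
    linarith
  refine ⟨C ((2 : ℝ) ^ k)⁻¹ * (s₁.map (Chebyshev.T ℝ)).sum, ?_, fun x hx => ?_⟩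
  · rw [← smul_eq_C_mul]
    refine Submodule.smul_mem _ _ (multiset_sum_mem _ fun p hp => ?_)
    obtain ⟨l, hl, rfl⟩ := Multiset.mem_map.1 hp
    rw [mem_degreeLT, Chebyshev.degree_T]
    exact_mod_cast (Multiset.mem_filter.1 hl).2
  · have hx' := hev x
    have hb : |(s₂.map fun l => (Chebyshev.T ℝ l).eval x).sum| ≤ Multiset.card s₂ := by
      refine (Multiset.abs_sum_le_sum_abs).trans ?_
      rw [Multiset.map_map]
      refine (Multiset.sum_le_card_nsmul _ 1 fun y hy => ?_).trans (by simp)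
      obtain ⟨l, -, rfl⟩ := Multiset.mem_map.1 hy
      exact Chebyshev.abs_eval_T_real_le_one l hx
    have h2 : (0 : ℝ) < 2 ^ k := by positivity
    have heq : x ^ k - eval x (C ((2 : ℝ) ^ k)⁻¹ * (s₁.map (Chebyshev.T ℝ)).sum) =
        (2 ^ k)⁻¹ * (s₂.map fun l => (Chebyshev.T ℝ l).eval x).sum := by
      rw [eval_mul, eval_C, ← coe_evalRingHom, map_multiset_sum, Multiset.map_map]
      rw [mul_pow] at hx'
      have : x ^ k = (2 ^ k)⁻¹ * (2 ^ k * x ^ k) := by field_simp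
      rw [this, hx']
      simp only [Function.comp_def, coe_evalRingHom]
      ring
    rw [heq, abs_mul, abs_of_pos (by positivity), le_div_iff₀ (Real.cosh_pos _),
      inv_mul_eq_div, div_mul_eq_mul_div, div_le_iff₀ h2]
    calc _ ≤ (Multiset.card s₂ : ℝ) * Real.cosh (m * σ) :=
          mul_le_mul_of_nonneg_right hb (Real.cosh_pos _).le
      _ ≤ _ := hcard
      _ = _ := by rw [mul_pow]; ring

-- Each power in the Taylor series is replaced by its Chebyshev truncation. The Taylor coefficients
-- are nonnegative, so the errors sum to at most exp(a cosh σ) / cosh(mσ).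
open Polynomial in
theorem exists_poly_approx_exp_mul (m : ℕ) {a : ℝ} (ha : 0 ≤ a) (σ : ℝ) :
    ∃ q ∈ degreeLT ℝ m, ∀ x : ℝ, |x| ≤ 1 →
      |Real.exp (a * x) - q.eval x| ≤ 4 * Real.exp (a * Real.cosh σ - m * σ) := by
  choose q hq hqx using fun k => exists_poly_approx_pow m k σ
  -- N puts the Taylor remainder below half of the allowed error; 2a ≤ N is what
  -- `Complex.exp_bound'` needs.
  obtain ⟨N, hN, hNa⟩ : ∃ N : ℕ, a ^ N / (N.factorial : ℝ) * 2 <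
      2 * Real.exp (a * Real.cosh σ - m * σ) ∧ 2 * a ≤ N := by
    have h := (FloorSemiring.tendsto_pow_div_factorial_atTop a).mul_const 2
    rw [zero_mul] at h
    exact ((h.eventually_lt_const (by positivity)).and
      (tendsto_natCast_atTop_atTop.eventually_ge_atTop (2 * a))).exists
  refine ⟨∑ k ∈ Finset.range N, (a ^ k / (k.factorial : ℝ)) • q k,
    Submodule.sum_mem _ fun k _ => Submodule.smul_mem _ _ (hq k), fun x hx => ?_⟩
  have h1 : |Real.exp (a * x) - ∑ k ∈ Finset.range N, (a * x) ^ k / (k.factorial : ℝ)| ≤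
      a ^ N / (N.factorial : ℝ) * 2 := by
    have hax : |a * x| ≤ a := by
      rw [abs_mul, abs_of_nonneg ha]; exact mul_le_of_le_one_right ha hx
    have h := Complex.exp_bound' (x := ((a * x : ℝ) : ℂ)) (n := N) (by
      rw [Complex.norm_real, Real.norm_eq_abs, div_le_iff₀ (by positivity)]
      push_cast
      linarith)
    have h' : |Real.exp (a * x) - ∑ k ∈ Finset.range N, (a * x) ^ k / (k.factorial : ℝ)| ≤
        |a * x| ^ N / (N.factorial : ℝ) * 2 := by
      rw [← Real.norm_eq_abs, ← Real.norm_eq_abs (a * x), ← Complex.norm_real,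
        ← Complex.norm_real (a * x)]
      exact_mod_cast h
    refine h'.trans ?_
    gcongr
  have h2 : |∑ k ∈ Finset.range N, (a * x) ^ k / (k.factorial : ℝ) -
      eval x (∑ k ∈ Finset.range N, (a ^ k / (k.factorial : ℝ)) • q k)| ≤
      Real.exp (a * Real.cosh σ) / Real.cosh (m * σ) := by
    rw [eval_finsetSum, ← Finset.sum_sub_distrib]
    calc _ ≤ ∑ k ∈ Finset.range N, (a * Real.cosh σ) ^ k / (k.factorial : ℝ) /
          Real.cosh (m * σ) := by
          refine (Finset.abs_sum_le_sum_abs _ _).trans (Finset.sum_le_sum fun k _ => ?_)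
          rw [eval_smul, smul_eq_mul, show (a * x) ^ k / (k.factorial : ℝ) -
            a ^ k / (k.factorial : ℝ) * eval x (q k) =
            a ^ k / (k.factorial : ℝ) * (x ^ k - eval x (q k)) by ring, abs_mul,
            abs_of_nonneg (by positivity)]
          refine (mul_le_mul_of_nonneg_left (hqx k x hx) (by positivity)).trans (le_of_eq ?_)
          rw [mul_pow]; ring
      _ ≤ _ := by
          rw [← Finset.sum_div]
          exact div_le_div_of_nonneg_right (Real.sum_le_exp_of_nonneg (by positivity) N)
            (Real.cosh_pos _).le
  have h3 : Real.exp (a * Real.cosh σ) / Real.cosh (m * σ) ≤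
      2 * Real.exp (a * Real.cosh σ - m * σ) := by
    rw [div_le_iff₀ (Real.cosh_pos _), Real.cosh_eq (m * σ), Real.exp_sub]
    have e1 := Real.exp_pos (m * σ)
    have e2 := Real.exp_pos (-(m * σ))
    have e3 := Real.exp_pos (a * Real.cosh σ)
    have : 2 * (Real.exp (a * Real.cosh σ) / Real.exp (m * σ)) *
        ((Real.exp (m * σ) + Real.exp (-(m * σ))) / 2) = Real.exp (a * Real.cosh σ) +
        Real.exp (a * Real.cosh σ) / Real.exp (m * σ) * Real.exp (-(m * σ)) := by
      field_simp
    rw [this]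
    exact le_add_of_nonneg_right (by positivity)
  calc _ ≤ _ := abs_sub_le _ (∑ k ∈ Finset.range N, (a * x) ^ k / (k.factorial : ℝ)) _
    _ ≤ _ := add_le_add h1 (h2.trans h3)
    _ ≤ _ := by linarith

open Polynomial in
/-- Polynomial approximation of the exponential on `[-2a, 0]`. -/
theorem exists_poly_approx_exp (m : ℕ) {a : ℝ} (ha : 0 < a) (σ : ℝ) :
    ∃ p ∈ degreeLT ℝ m, ∀ x ∈ Set.Icc (-(2 * a)) 0,
      |Real.exp x - p.eval x| ≤ 4 * Real.exp (a * (Real.cosh σ - 1) - m * σ) := by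
  obtain ⟨q, hq, hqx⟩ := exists_poly_approx_exp_mul m ha.le σ
  have hlin : (C a⁻¹ * X + 1 : ℝ[X]).natDegree = 1 := by
    rw [← C_1]; exact natDegree_linear (inv_ne_zero ha.ne')
  -- x = a(u - 1) with |u| ≤ 1; the factor e^{-a} turns a cosh σ into a(cosh σ - 1).
  refine ⟨Real.exp (-a) • q.comp (C a⁻¹ * X + 1), Submodule.smul_mem _ _ ?_, fun x hx => ?_⟩
  · rw [mem_degreeLT] at hq ⊢
    by_cases h0 : q = 0
    · simp [h0]
    · refine degree_le_natDegree.trans_lt ?_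
      rw [natDegree_comp, hlin, mul_one, ← degree_eq_natDegree h0]
      exact hq
  · have h1 : |a⁻¹ * x + 1| ≤ 1 := by
      have e : a⁻¹ * x + 1 = (x + a) / a := by field_simp
      rw [e, abs_div, abs_of_pos ha, div_le_one ha, abs_le]
      constructor <;> linarith [hx.1, hx.2]
    have h2 := hqx _ h1
    have h3 : Real.exp x - eval x (Real.exp (-a) • q.comp (C a⁻¹ * X + 1)) =
        Real.exp (-a) * (Real.exp (a * (a⁻¹ * x + 1)) - eval (a⁻¹ * x + 1) q) := by
      rw [mul_sub, ← Real.exp_add]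
      simp only [eval_smul, eval_comp, eval_add, eval_mul, eval_C, eval_X, eval_one, smul_eq_mul]
      congr 2
      field_simp
      ring
    rw [h3, abs_mul, abs_of_pos (Real.exp_pos _)]
    refine (mul_le_mul_of_nonneg_left h2 (Real.exp_pos _).le).trans (le_of_eq ?_)
    rw [mul_left_comm, ← Real.exp_add]
    ring_nf

/-! ### Choice of σ in the two regimes -/

/-- The Taylor coefficient 1/2 is relaxed to 3/5: at σ = m/a the exponent becomes (3/5 - 1)m²/a,
which is -m²/(5ρt) for a = 2ρt. -/
theorem cosh_sub_one_le {s : ℝ} (hs0 : 0 ≤ s) (hs : s ≤ 1) : Real.cosh s - 1 ≤ 3 / 5 * s ^ 2 := by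
  have h1 := (abs_le.1 (Real.exp_bound (x := s) (by rwa [abs_of_nonneg hs0])
    (n := 4) (by norm_num))).2
  have h2 := (abs_le.1 (Real.exp_bound (x := -s) (by rwa [abs_neg, abs_of_nonneg hs0])
    (n := 4) (by norm_num))).2
  rw [abs_neg] at h2
  rw [abs_of_nonneg hs0] at h1 h2
  simp only [Finset.sum_range_succ, Finset.sum_range_zero, Nat.factorial] at h1 h2
  norm_num at h1 h2
  have h4 : s ^ 4 ≤ s ^ 2 := pow_le_pow_of_le_one hs0 hs (by norm_num)
  rw [Real.cosh_eq]
  nlinarith [sq_nonneg s]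

/-- σ = m/a ≤ 1 minimizes the quadratic model aσ²/2 - mσ. -/
theorem exp_bound_of_le {a m : ℝ} (hm : 0 < m) (hma : m ≤ a) :
    8 * Real.exp (a * (Real.cosh (m / a) - 1) - m * (m / a)) ≤
      10 * ((2 * a) ^ 2 / m ^ 2) * Real.exp (-(2 * m ^ 2 / (5 * a))) := by
  have ha : 0 < a := hm.trans_le hma
  have h1 := cosh_sub_one_le (s := m / a) (by positivity) ((div_le_one ha).2 hma)
  have h2 : a * (Real.cosh (m / a) - 1) - m * (m / a) ≤ -(2 * m ^ 2 / (5 * a)) := by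
    have := mul_le_mul_of_nonneg_left h1 ha.le
    have e : a * (3 / 5 * (m / a) ^ 2) - m * (m / a) = -(2 * m ^ 2 / (5 * a)) := by
      field_simp; ring
    linarith
  have h3 : 1 ≤ (2 * a) ^ 2 / m ^ 2 := by
    rw [one_le_div (by positivity)]
    gcongr
    linarith
  calc _ ≤ 8 * Real.exp (-(2 * m ^ 2 / (5 * a))) := by gcongr
    _ ≤ _ := mul_le_mul_of_nonneg_right (by linarith) (Real.exp_pos _).le

/-- The minimizer of a cosh σ - mσ has sinh σ = m/a, hence e^σ ≈ 2m/a. With e^σ = 2m/a, a cosh σ = m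
+ a²/(4m), and e^{m - mσ} is the m-th power in the bound. -/
theorem exp_bound_of_ge {a : ℝ} {m : ℕ} (ha : 0 < a) (hma : a ≤ m) :
    8 * Real.exp (a * (Real.cosh (Real.log (2 * m / a)) - 1) - m * Real.log (2 * m / a)) ≤
      80 / a * Real.exp (-(a / 2)) * (Real.exp 1 * (a / 2) / m) ^ m := by
  have hm : (0 : ℝ) < m := ha.trans_le hma
  have hr : 0 < 2 * (m : ℝ) / a := by positivity
  have h1 : Real.exp (a * (Real.cosh (Real.log (2 * m / a)) - 1) - m * Real.log (2 * m / a)) =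
      Real.exp (a ^ 2 / (4 * m) - a) * (Real.exp 1 * (a / 2) / m) ^ m := by
    rw [Real.cosh_log hr]
    have e : a * ((2 * m / a + (2 * m / a)⁻¹) / 2 - 1) - m * Real.log (2 * m / a) =
      (a ^ 2 / (4 * m) - a) + m * (1 + -Real.log (2 * m / a)) := by
      field_simp; ring
    rw [e, Real.exp_add, Real.exp_nat_mul, Real.exp_add, ← Real.log_inv,
      Real.exp_log (by positivity)]
    congr 2
    field_simp
  -- One part, -a/2, becomes the factor e^{-ρt}; the other, -a/4, is traded for 10/a.
  have h2 : a ^ 2 / (4 * m) - a ≤ -(a / 2) + -(a / 4) := by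
    have : a ^ 2 / (4 * m) ≤ a / 4 := by
      rw [div_le_div_iff₀ (by positivity) (by norm_num)]
      nlinarith
    linarith
  have h3 : Real.exp (-(a / 4)) ≤ 10 / a := by
    rw [Real.exp_neg, inv_le_comm₀ (Real.exp_pos _) (by positivity), inv_div]
    have := Real.add_one_le_exp (a / 4)
    linarith
  rw [h1, ← mul_assoc]
  refine mul_le_mul_of_nonneg_right ?_ (by positivity)
  calc _ ≤ 8 * (Real.exp (-(a / 2)) * Real.exp (-(a / 4))) := by
        rw [← Real.exp_add]; gcongr
    _ ≤ 8 * (Real.exp (-(a / 2)) * (10 / a)) := by gcongr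
    _ = _ := by ring

/-! ### Arnoldi process: orthonormality, compression, exactness -/

section Arnoldi

variable {n : ℕ} (A : Matrix (Fin n) (Fin n) ℂ) (b : EuclideanSpace ℂ (Fin n))

open Matrix

/-- At breakdown both sides vanish, so the recurrence needs no case distinction later. -/
theorem arnoldiSub_smul_arnoldiVec_succ (j : ℕ) :
    (arnoldiSub A b j : ℂ) • arnoldiVec A b (j + 1) =
      toEuclideanLin A (arnoldiVec A b j) - ∑ i : Fin (j + 1),
        inner ℂ (arnoldiVec A b i) (toEuclideanLin A (arnoldiVec A b j)) • arnoldiVec A b i := by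
  rw [arnoldiVec, arnoldiSub, smul_smul]
  by_cases h : toEuclideanLin A (arnoldiVec A b j) - ∑ i : Fin (j + 1),
      inner ℂ (arnoldiVec A b i) (toEuclideanLin A (arnoldiVec A b j)) • arnoldiVec A b i = 0
  · rw [h]; simp
  · rw [mul_inv_cancel₀ (by simpa using h), one_smul]

theorem toEuclideanLin_arnoldiVec (j : ℕ) :
    toEuclideanLin A (arnoldiVec A b j) =
      (arnoldiSub A b j : ℂ) • arnoldiVec A b (j + 1) + ∑ i : Fin (j + 1),
        inner ℂ (arnoldiVec A b i) (toEuclideanLin A (arnoldiVec A b j)) • arnoldiVec A b i := by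
  rw [arnoldiSub_smul_arnoldiVec_succ, sub_add_cancel]

theorem norm_arnoldiVec {j : ℕ} (h : arnoldiVec A b j ≠ 0) : ‖arnoldiVec A b j‖ = 1 := by
  have key (w : EuclideanSpace ℂ (Fin n)) (hw : (‖w‖ : ℂ)⁻¹ • w ≠ 0) :
      ‖(‖w‖ : ℂ)⁻¹ • w‖ = 1 :=
    norm_smul_inv_norm (𝕜 := ℂ) (by rintro rfl; simp at hw)
  cases j with
  | zero => rw [arnoldiVec] at h ⊢; exact key _ h
  | succ j => rw [arnoldiVec] at h ⊢; exact key _ h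

theorem inner_arnoldiVec_self {j : ℕ} (h : arnoldiVec A b j ≠ 0) :
    inner ℂ (arnoldiVec A b j) (arnoldiVec A b j) = 1 := by
  rw [inner_self_eq_norm_sq_to_K, norm_arnoldiVec A b h]; simp

theorem inner_arnoldiVec_of_lt (j : ℕ) :
    ∀ i < j, inner ℂ (arnoldiVec A b i) (arnoldiVec A b j) = 0 := by
  induction j using Nat.strong_induction_on with
  | _ j ih =>
    intro i hij
    cases j with
    | zero => omega
    | succ j =>
      by_cases hi : arnoldiVec A b i = 0
      · rw [hi, inner_zero_left]
      rw [arnoldiVec, inner_smul_right, inner_sub_right, inner_sum]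
      refine mul_eq_zero_of_right _ (sub_eq_zero.2 ?_)
      rw [Finset.sum_eq_single (⟨i, hij⟩ : Fin (j + 1))]
      · rw [inner_smul_right, inner_arnoldiVec_self A b hi, mul_one]
      · intro k _ hk
        have hk' : (k : ℕ) ≠ i := fun h => hk (Fin.ext h)
        rw [inner_smul_right]
        refine mul_eq_zero_of_right _ ?_
        rcases lt_or_gt_of_ne hk' with h | h
        · rw [← inner_conj_symm, ih i hij k h, map_zero]
        · exact ih k k.2 i h
      · simp

theorem inner_arnoldiVec_of_ne {i j : ℕ} (h : i ≠ j) :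
    inner ℂ (arnoldiVec A b i) (arnoldiVec A b j) = 0 := by
  rcases lt_or_gt_of_ne h with h | h
  · exact inner_arnoldiVec_of_lt A b j i h
  · rw [← inner_conj_symm, inner_arnoldiVec_of_lt A b i j h, map_zero]

theorem norm_smul_arnoldiVec_zero : (‖b‖ : ℂ) • arnoldiVec A b 0 = b := by
  rw [arnoldiVec, smul_smul]
  by_cases h : b = 0
  · simp [h]
  · rw [mul_inv_cancel₀ (by simpa using h), one_smul]

theorem toLp_pow_mulVec_mem_span_arnoldiVec (k : ℕ) :
    WithLp.toLp 2 ((A ^ k) *ᵥ ⇑b) ∈ Submodule.span ℂ (arnoldiVec A b '' Set.Iic k) := by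
  induction k with
  | zero =>
    rw [pow_zero, one_mulVec]
    have h : (‖b‖ : ℂ) • arnoldiVec A b 0 ∈
        Submodule.span ℂ (arnoldiVec A b '' Set.Iic 0) :=
      Submodule.smul_mem _ _ (Submodule.subset_span ⟨0, Set.self_mem_Iic, rfl⟩)
    rwa [norm_smul_arnoldiVec_zero] at h
  | succ k ih =>
    rw [pow_succ', ← mulVec_mulVec]
    change toEuclideanLin A (WithLp.toLp 2 ((A ^ k) *ᵥ ⇑b)) ∈ _
    refine (Submodule.map_le_iff_le_comap.2 ?_) (Submodule.mem_map_of_mem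
      (f := (toEuclideanLin A : EuclideanSpace ℂ (Fin n) →ₗ[ℂ] _)) ih)
    rw [Submodule.span_le]
    rintro _ ⟨j, hj, rfl⟩
    have hj : j ≤ k := hj
    rw [SetLike.mem_coe, Submodule.mem_comap]
    rw [toEuclideanLin_arnoldiVec]
    refine Submodule.add_mem _ (Submodule.smul_mem _ _ (Submodule.subset_span ⟨j + 1, ?_, rfl⟩))
      (Submodule.sum_mem _ fun i _ => Submodule.smul_mem _ _
        (Submodule.subset_span ⟨i, ?_, rfl⟩))
    · exact Nat.succ_le_succ hj
    · exact (Nat.lt_succ_iff.1 i.2).trans (hj.trans (Nat.le_succ k))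

theorem arnoldiBasis_conjTranspose_mulVec (m : ℕ) (x : EuclideanSpace ℂ (Fin n))
    (i : ArnoldiIndex A b m) :
    ((arnoldiBasis A b m)ᴴ *ᵥ ⇑x) i = inner ℂ (arnoldiVec A b i.1) x := by
  rw [EuclideanSpace.inner_eq_star_dotProduct, dotProduct_comm]
  rfl

theorem arnoldiBasis_conjTranspose_mul_mul_apply (m : ℕ) (i j : ArnoldiIndex A b m) :
    ((arnoldiBasis A b m)ᴴ * A * arnoldiBasis A b m) i j =
      inner ℂ (arnoldiVec A b i.1) (toEuclideanLin A (arnoldiVec A b j.1)) := by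
  rw [← arnoldiBasis_conjTranspose_mulVec, Matrix.mul_assoc]
  rfl

theorem arnoldiBasis_conjTranspose_mul_self (m : ℕ) :
    (arnoldiBasis A b m)ᴴ * arnoldiBasis A b m = 1 := by
  ext i j
  have h : ((arnoldiBasis A b m)ᴴ * arnoldiBasis A b m) i j =
      inner ℂ (arnoldiVec A b i.1) (arnoldiVec A b j.1) := by
    rw [← arnoldiBasis_conjTranspose_mulVec]
    rfl
  rw [h]
  by_cases hij : i = j
  · subst hij
    rw [inner_arnoldiVec_self A b i.2, one_apply_eq]
  · rw [one_apply_ne hij, inner_arnoldiVec_of_ne]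
    exact fun h => hij (Subtype.ext (Fin.ext h))

/-- The Hessenberg matrix is the compression of `A` to the Krylov space. -/
theorem arnoldiHess_eq (m : ℕ) :
    arnoldiHess A b m = (arnoldiBasis A b m)ᴴ * A * arnoldiBasis A b m := by
  ext i j
  rw [arnoldiBasis_conjTranspose_mul_mul_apply, arnoldiHess, of_apply]
  split_ifs with h1 h2
  · rfl
  · rw [toEuclideanLin_arnoldiVec, inner_add_right, inner_smul_right, inner_sum, h2,
      inner_arnoldiVec_self A b (h2 ▸ i.2), Finset.sum_eq_zero]
    · simp
    · intro k _
      rw [inner_smul_right, inner_arnoldiVec_of_ne A b (by omega), mul_zero]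
  · rw [toEuclideanLin_arnoldiVec, inner_add_right, inner_smul_right, inner_sum,
      inner_arnoldiVec_of_ne A b h2, Finset.sum_eq_zero]
    · simp
    · intro k _
      rw [inner_smul_right, inner_arnoldiVec_of_ne A b (by omega), mul_zero]

theorem arnoldiBasis_conjTranspose_mulVec_start (m : ℕ) :
    (arnoldiBasis A b m)ᴴ *ᵥ ⇑b = (‖b‖ : ℂ) • arnoldiE1 A b m := by
  ext i
  rw [arnoldiBasis_conjTranspose_mulVec, Pi.smul_apply, smul_eq_mul, arnoldiE1]
  have h := congrArg (inner ℂ (arnoldiVec A b i.1)) (norm_smul_arnoldiVec_zero A b)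
  rw [inner_smul_right] at h
  rw [← h]
  congr 1
  split_ifs with h
  · rw [h, inner_arnoldiVec_self A b (h ▸ i.2)]
  · exact inner_arnoldiVec_of_ne A b h

theorem arnoldiBasis_mul_conjTranspose_mulVec (m : ℕ) {x : EuclideanSpace ℂ (Fin n)}
    (hx : x ∈ Submodule.span ℂ (arnoldiVec A b '' Set.Iio m)) :
    (arnoldiBasis A b m * (arnoldiBasis A b m)ᴴ) *ᵥ ⇑x = ⇑x := by
  induction hx using Submodule.span_induction with
  | mem x hx =>
    obtain ⟨j, hj, rfl⟩ := hx
    by_cases h0 : arnoldiVec A b j = 0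
    · rw [h0]; exact mulVec_zero _
    · have hcol : ⇑(arnoldiVec A b j) = arnoldiBasis A b m *ᵥ
          Pi.single (⟨⟨j, hj⟩, h0⟩ : ArnoldiIndex A b m) 1 := by
        rw [mulVec_single_one]; rfl
      rw [hcol, mulVec_mulVec, Matrix.mul_assoc, arnoldiBasis_conjTranspose_mul_self,
        Matrix.mul_one]
  | zero => exact mulVec_zero _
  | add x y _ _ hx hy =>
    change _ *ᵥ (⇑x + ⇑y) = ⇑x + ⇑y
    rw [mulVec_add, hx, hy]
  | smul c x _ hx =>
    change _ *ᵥ (c • ⇑x) = c • ⇑x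
    rw [mulVec_smul, hx]

/-- The Arnoldi approximation is exact for powers of degree less than `m`. -/
theorem arnoldiBasis_mulVec_pow {m k : ℕ} (hk : k < m) :
    arnoldiBasis A b m *ᵥ (arnoldiHess A b m ^ k *ᵥ ((‖b‖ : ℂ) • arnoldiE1 A b m)) =
      (A ^ k) *ᵥ ⇑b := by
  -- V Vᴴ fixes the Krylov vectors A^l b with l < m, so the projections hidden in powers of Vᴴ A V
  -- do nothing.
  have hfix (l : ℕ) (hl : l < m) : (arnoldiBasis A b m * (arnoldiBasis A b m)ᴴ) *ᵥ
      ((A ^ l) *ᵥ ⇑b) = (A ^ l) *ᵥ ⇑b :=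
    arnoldiBasis_mul_conjTranspose_mulVec A b m
      (Submodule.span_mono (Set.image_mono fun i (hi : i ≤ l) => lt_of_le_of_lt hi hl)
        (toLp_pow_mulVec_mem_span_arnoldiVec A b l))
  induction k with
  | zero =>
    rw [← arnoldiBasis_conjTranspose_mulVec_start, pow_zero, one_mulVec, mulVec_mulVec]
    simpa using hfix 0 hk
  | succ k ih =>
    have ih := ih (by omega)
    have hVG : arnoldiBasis A b m * arnoldiHess A b m =
        arnoldiBasis A b m * (arnoldiBasis A b m)ᴴ * A * arnoldiBasis A b m := by
      rw [arnoldiHess_eq]; simp only [Matrix.mul_assoc]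
    rw [pow_succ', ← mulVec_mulVec, mulVec_mulVec, hVG, ← mulVec_mulVec, ih, ← mulVec_mulVec,
      mulVec_mulVec _ A, ← pow_succ']
    exact hfix _ hk

theorem smul_vecMulVec_arnoldiE1 (y z : EuclideanSpace ℂ (Fin n)) (m : ℕ) :
    ((‖y‖ : ℂ) * (‖z‖ : ℂ)) • vecMulVec (arnoldiE1 A y m) (star (arnoldiE1 Aᴴ z m)) =
      vecMulVec ((arnoldiBasis A y m)ᴴ *ᵥ ⇑y) (star ((arnoldiBasis Aᴴ z m)ᴴ *ᵥ ⇑z)) := by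
  rw [arnoldiBasis_conjTranspose_mulVec_start, arnoldiBasis_conjTranspose_mulVec_start,
    star_smul, smul_vecMulVec, vecMulVec_smul, smul_smul]
  simp

/-- The left factor is one-sided exactness for A, y; the right one is the adjoint of that for Aᴴ, z.
-/
theorem arnoldi_exact (y z : EuclideanSpace ℂ (Fin n)) (m : ℕ) {i j : ℕ} (hi : i < m)
    (hj : j < m) :
    arnoldiBasis A y m * (arnoldiHess A y m ^ i *
      vecMulVec ((arnoldiBasis A y m)ᴴ *ᵥ ⇑y) (star ((arnoldiBasis Aᴴ z m)ᴴ *ᵥ ⇑z)) *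
      (arnoldiHess Aᴴ z m)ᴴ ^ j) * (arnoldiBasis Aᴴ z m)ᴴ =
    A ^ i * vecMulVec ⇑y (star ⇑z) * A ^ j := by
  have h1 := arnoldiBasis_mulVec_pow A y hi
  have h2 := congrArg star (arnoldiBasis_mulVec_pow Aᴴ z hj)
  rw [star_mulVec, star_mulVec, star_mulVec, conjTranspose_pow, conjTranspose_pow,
    conjTranspose_conjTranspose] at h2
  rw [arnoldiBasis_conjTranspose_mulVec_start, arnoldiBasis_conjTranspose_mulVec_start,
    mul_vecMulVec, vecMulVec_mul, mul_vecMulVec, vecMulVec_mul, mul_vecMulVec,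
    vecMulVec_mul, h1, h2]

end Arnoldi

/-! ### Derivative of the exponential in special directions -/

section ExpDerivative

variable {𝔸 : Type*} [NormedRing 𝔸] [NormedAlgebra ℂ 𝔸] [CompleteSpace 𝔸]

theorem hasFDerivAt_fderiv_exp (S : 𝔸) :
    HasFDerivAt (fun X : 𝔸 => NormedSpace.exp X) (fderiv ℂ (fun X : 𝔸 => NormedSpace.exp X) S) S :=
  (NormedSpace.exp_analytic (𝕂 := ℂ) S).differentiableAt.hasFDerivAt

theorem hasDerivAt_exp_smul_zero (B : 𝔸) :
    HasDerivAt (fun s : ℂ => NormedSpace.exp (s • B)) B 0 := by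
  simpa using hasDerivAt_exp_smul_const (𝕂 := ℂ) B (0 : ℂ)

theorem fderiv_exp_of_commute {S B : 𝔸} (h : Commute S B) :
    fderiv ℂ (fun X : 𝔸 => NormedSpace.exp X) S B = NormedSpace.exp S * B := by
  let _ : NormedAlgebra ℚ 𝔸 := NormedAlgebra.restrictScalars ℚ ℂ 𝔸
  have h1 : HasDerivAt (fun s : ℂ => S + s • B) B 0 := by
    simpa using ((hasDerivAt_id (0 : ℂ)).smul_const B).const_add S
  have h2 : HasDerivAt (fun s : ℂ => NormedSpace.exp (S + s • B))
      (fderiv ℂ (fun X : 𝔸 => NormedSpace.exp X) S B) 0 := by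
    have := hasFDerivAt_fderiv_exp S
    refine HasFDerivAt.comp_hasDerivAt (0 : ℂ) (f := fun s : ℂ => S + s • B) ?_ h1
    simpa using this
  have h3 : HasDerivAt (fun s : ℂ => NormedSpace.exp (S + s • B)) (NormedSpace.exp S * B) 0 := by
    have := (hasDerivAt_exp_smul_zero B).const_mul (NormedSpace.exp S)
    refine this.congr_of_eventuallyEq (Filter.Eventually.of_forall fun s => ?_)
    exact NormedSpace.exp_add_of_commute (h.smul_right s)
  exact h2.unique h3

/-- The derivative of the exponential in the direction of a commutator. -/
theorem fderiv_exp_commutator (S B : 𝔸) :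
    fderiv ℂ (fun X : 𝔸 => NormedSpace.exp X) S (B * S - S * B) =
      B * NormedSpace.exp S - NormedSpace.exp S * B := by
  let _ : NormedAlgebra ℚ 𝔸 := NormedAlgebra.restrictScalars ℚ ℂ 𝔸
  -- The curve e^{sB} X e^{-sB} has velocity BX - XB at 0. It is used for X = S and X = exp S, since
  -- exp commutes with conjugation.
  have hconj (X : 𝔸) : HasDerivAt
      (fun s : ℂ => NormedSpace.exp (s • B) * X * NormedSpace.exp (s • -B)) (B * X - X * B) 0 := by
    have := ((hasDerivAt_exp_smul_zero B).mul_const X).mul (hasDerivAt_exp_smul_zero (-B))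
    exact this.congr_deriv (by simp [sub_eq_add_neg])
  have h2 : HasDerivAt (fun s : ℂ => NormedSpace.exp
      (NormedSpace.exp (s • B) * S * NormedSpace.exp (s • -B)))
      (fderiv ℂ (fun X : 𝔸 => NormedSpace.exp X) S (B * S - S * B)) 0 := by
    refine HasFDerivAt.comp_hasDerivAt (0 : ℂ)
      (f := fun s : ℂ => NormedSpace.exp (s • B) * S * NormedSpace.exp (s • -B)) ?_ (hconj S)
    simpa using hasFDerivAt_fderiv_exp S
  refine h2.unique ((hconj (NormedSpace.exp S)).congr_of_eventuallyEq
    (Filter.Eventually.of_forall fun s => ?_))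
  have hc : Commute (s • B) (s • -B) := by
    rw [smul_neg]; exact (Commute.refl _).neg_right
  have e1 : NormedSpace.exp (s • B) * NormedSpace.exp (s • -B) = 1 := by
    rw [← NormedSpace.exp_add_of_commute hc]; simp
  have e2 : NormedSpace.exp (s • -B) * NormedSpace.exp (s • B) = 1 := by
    rw [← NormedSpace.exp_add_of_commute hc.symm]; simp
  exact NormedSpace.exp_units_conj (⟨_, _, e1, e2⟩ : 𝔸ˣ) S

end ExpDerivative

/-! ### Bivariate functions of Hermitian matrices -/

section Bivariate

open Matrix

variable {p q : Type*} [Fintype p] [DecidableEq p] [Fintype q] [DecidableEq q]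
  {S : Matrix p p ℂ} {T : Matrix q q ℂ}

/-- The function `f` of a Hermitian matrix, through its diagonalization. -/
noncomputable def hermitianFun (hS : S.IsHermitian) (f : ℂ → ℂ) : Matrix p p ℂ :=
  (hS.eigenvectorUnitary : Matrix p p ℂ) * diagonal (fun k => f (hS.eigenvalues k)) *
    (hS.eigenvectorUnitary : Matrix p p ℂ)ᴴ

/-- The bivariate function `φ` of a pair of Hermitian matrices `S`, `T`, applied to `M`: if
`φ x y = f x * g y`, then this is `f(S) M g(T)`. -/
noncomputable def bivariateFun (hS : S.IsHermitian) (hT : T.IsHermitian) (φ : ℂ → ℂ → ℂ) (M : Matrix p q ℂ) :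
    Matrix p q ℂ :=
  (hS.eigenvectorUnitary : Matrix p p ℂ) *
    of (fun k l => φ (hS.eigenvalues k) (hT.eigenvalues l) *
      ((hS.eigenvectorUnitary : Matrix p p ℂ)ᴴ * M * (hT.eigenvectorUnitary : Matrix q q ℂ)) k l) *
    (hT.eigenvectorUnitary : Matrix q q ℂ)ᴴ

theorem eigenvectorUnitary_mul_conjTranspose (hS : S.IsHermitian) :
    (hS.eigenvectorUnitary : Matrix p p ℂ) * (hS.eigenvectorUnitary : Matrix p p ℂ)ᴴ = 1 :=
  Unitary.coe_mul_star_self _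

theorem conjTranspose_mul_eigenvectorUnitary (hS : S.IsHermitian) :
    (hS.eigenvectorUnitary : Matrix p p ℂ)ᴴ * (hS.eigenvectorUnitary : Matrix p p ℂ) = 1 :=
  Unitary.coe_star_mul_self _

theorem hermitianFun_id (hS : S.IsHermitian) : hermitianFun hS id = S :=
  hS.spectral_theorem.symm

theorem hermitianFun_const (hS : S.IsHermitian) (c : ℂ) :
    hermitianFun hS (fun _ => c) = c • 1 := by
  rw [hermitianFun, ← smul_one_eq_diagonal, Matrix.mul_smul, Matrix.smul_mul, Matrix.mul_one,
    eigenvectorUnitary_mul_conjTranspose]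

theorem hermitianFun_mul (hS : S.IsHermitian) (f g : ℂ → ℂ) :
    hermitianFun hS f * hermitianFun hS g = hermitianFun hS (fun x => f x * g x) := by
  simp only [hermitianFun]
  rw [← diagonal_mul_diagonal]
  simp only [Matrix.mul_assoc]
  rw [← Matrix.mul_assoc _ᴴ, conjTranspose_mul_eigenvectorUnitary, Matrix.one_mul]

theorem hermitianFun_sub (hS : S.IsHermitian) (f g : ℂ → ℂ) :
    hermitianFun hS f - hermitianFun hS g = hermitianFun hS (fun x => f x - g x) := by
  simp only [hermitianFun]
  rw [← diagonal_sub, Matrix.mul_sub, Matrix.sub_mul]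

theorem hermitianFun_pow (hS : S.IsHermitian) (i : ℕ) :
    hermitianFun hS (fun x => x ^ i) = S ^ i := by
  induction i with
  | zero => simpa using hermitianFun_const hS 1
  | succ i ih =>
    have h := hermitianFun_mul hS (fun x => x ^ i) id
    rw [hermitianFun_id, ih] at h
    rw [pow_succ, h]
    rfl

theorem inv_smul_one_sub (hS : S.IsHermitian) {ζ : ℂ} (hζ : ∀ k, ζ ≠ hS.eigenvalues k) :
    (ζ • (1 : Matrix p p ℂ) - S)⁻¹ = hermitianFun hS (fun x => (ζ - x)⁻¹) := by
  refine inv_eq_right_inv ?_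
  conv_lhs => rw [← hermitianFun_const hS ζ]
  nth_rw 2 [← hermitianFun_id hS]
  rw [hermitianFun_sub, hermitianFun_mul, ← one_smul ℂ (1 : Matrix p p ℂ),
    ← hermitianFun_const hS]
  simp only [hermitianFun, id]
  congr 3
  ext k
  exact mul_inv_cancel₀ (sub_ne_zero.2 (hζ k))

theorem exp_eq_hermitianFun (hS : S.IsHermitian) :
    NormedSpace.exp S = hermitianFun hS Complex.exp := by
  conv_lhs => rw [← hermitianFun_id hS, hermitianFun]
  have hinv : ((hS.eigenvectorUnitary : Matrix p p ℂ))⁻¹ =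
      (hS.eigenvectorUnitary : Matrix p p ℂ)ᴴ :=
    inv_eq_right_inv (eigenvectorUnitary_mul_conjTranspose hS)
  have hu : IsUnit (hS.eigenvectorUnitary : Matrix p p ℂ) :=
    IsUnit.of_mul_eq_one _ (eigenvectorUnitary_mul_conjTranspose hS)
  rw [← hinv, Matrix.exp_conj _ _ hu, exp_diagonal, hinv, hermitianFun]
  congr 3
  ext k
  rw [Pi.coe_exp, Complex.exp_eq_exp_ℂ]
  rfl

theorem bivariateFun_mul (hS : S.IsHermitian) (hT : T.IsHermitian) (f g : ℂ → ℂ)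
    (M : Matrix p q ℂ) :
    bivariateFun hS hT (fun x y => f x * g y) M = hermitianFun hS f * M * hermitianFun hT g := by
  have h : of (fun k l => f (hS.eigenvalues k) * g (hT.eigenvalues l) *
      ((hS.eigenvectorUnitary : Matrix p p ℂ)ᴴ * M * (hT.eigenvectorUnitary : Matrix q q ℂ)) k l) =
      diagonal (fun k => f (hS.eigenvalues k)) *
      ((hS.eigenvectorUnitary : Matrix p p ℂ)ᴴ * M * (hT.eigenvectorUnitary : Matrix q q ℂ)) *
      diagonal (fun l => g (hT.eigenvalues l)) := by
    ext k l
    rw [mul_diagonal, diagonal_mul, of_apply]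
    ring
  rw [bivariateFun, h, hermitianFun, hermitianFun]
  simp only [Matrix.mul_assoc]

theorem bivariateFun_sub (hS : S.IsHermitian) (hT : T.IsHermitian) (φ ψ : ℂ → ℂ → ℂ)
    (M : Matrix p q ℂ) :
    bivariateFun hS hT φ M - bivariateFun hS hT ψ M =
      bivariateFun hS hT (fun x y => φ x y - ψ x y) M := by
  simp only [bivariateFun]
  rw [← Matrix.sub_mul, ← Matrix.mul_sub]
  congr 2
  ext k l
  simp [sub_mul]

theorem bivariateFun_sum {ι : Type*} (s : Finset ι) (hS : S.IsHermitian) (hT : T.IsHermitian)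
    (c : ι → ℂ) (φ : ι → ℂ → ℂ → ℂ) (M : Matrix p q ℂ) :
    bivariateFun hS hT (fun x y => ∑ i ∈ s, c i * φ i x y) M =
      ∑ i ∈ s, c i • bivariateFun hS hT (φ i) M := by
  have h : of (fun k l => (∑ i ∈ s, c i * φ i (hS.eigenvalues k) (hT.eigenvalues l)) *
      ((hS.eigenvectorUnitary : Matrix p p ℂ)ᴴ * M * (hT.eigenvectorUnitary : Matrix q q ℂ)) k l) =
      ∑ i ∈ s, c i • of (fun k l => φ i (hS.eigenvalues k) (hT.eigenvalues l) *
      ((hS.eigenvectorUnitary : Matrix p p ℂ)ᴴ * M *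
        (hT.eigenvectorUnitary : Matrix q q ℂ)) k l) := by
    ext k l
    rw [Matrix.sum_apply, of_apply, Finset.sum_mul]
    exact Finset.sum_congr rfl fun i _ => mul_assoc _ _ _
  simp only [bivariateFun]
  rw [h, Matrix.mul_sum, Matrix.sum_mul]
  exact Finset.sum_congr rfl fun i _ => by rw [Matrix.mul_smul, Matrix.smul_mul]

omit [DecidableEq p] in
theorem l2_opNorm_le_one_of_conjTranspose_mul_self {V : Matrix p q ℂ} (hV : Vᴴ * V = 1) :
    ‖V‖ ≤ 1 := by
  have h1 : ‖(1 : Matrix q q ℂ)‖ ≤ 1 := by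
    rw [← diagonal_one, l2_opNorm_diagonal]
    exact (pi_norm_le_iff_of_nonneg zero_le_one).2 fun _ => by simp
  have h2 := l2_opNorm_conjTranspose_mul_self V
  rw [hV] at h2
  nlinarith [norm_nonneg V]

-- Cauchy–Schwarz: entrywise domination by a rank-one matrix bounds the operator norm.
omit [DecidableEq p] in
theorem l2_opNorm_le_of_entry_le {M : Matrix p q ℂ} {C : ℝ} (hC : 0 ≤ C)
    (a : EuclideanSpace ℂ p) (b : EuclideanSpace ℂ q)
    (h : ∀ k l, ‖M k l‖ ≤ C * (‖a k‖ * ‖b l‖)) : ‖M‖ ≤ C * (‖a‖ * ‖b‖) := by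
  rw [l2_opNorm_def]
  refine ContinuousLinearMap.opNorm_le_bound _ (by positivity) fun x => ?_
  have hx (k : p) : ‖(M *ᵥ ⇑x) k‖ ≤ C * (‖b‖ * ‖x‖) * ‖a k‖ := by
    calc ‖(M *ᵥ ⇑x) k‖ ≤ ∑ l, ‖M k l * x l‖ := norm_sum_le _ _
      _ ≤ ∑ l, C * ‖a k‖ * (‖b l‖ * ‖x l‖) := by
          refine Finset.sum_le_sum fun l _ => ?_
          rw [norm_mul]
          calc _ ≤ C * (‖a k‖ * ‖b l‖) * ‖x l‖ :=
                mul_le_mul_of_nonneg_right (h k l) (norm_nonneg _)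
            _ = _ := by ring
      _ = C * ‖a k‖ * ∑ l, ‖b l‖ * ‖x l‖ := by rw [Finset.mul_sum]
      _ ≤ C * ‖a k‖ * (‖b‖ * ‖x‖) := by
          refine mul_le_mul_of_nonneg_left ?_ (by positivity)
          rw [EuclideanSpace.norm_eq, EuclideanSpace.norm_eq]
          exact Real.sum_mul_le_sqrt_mul_sqrt _ _ _
      _ = _ := by ring
  change ‖WithLp.toLp 2 (M *ᵥ ⇑x)‖ ≤ _
  rw [EuclideanSpace.norm_eq]
  refine Real.sqrt_le_iff.2 ⟨by positivity, ?_⟩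
  calc _ ≤ ∑ k, (C * (‖b‖ * ‖x‖) * ‖a k‖) ^ 2 :=
        Finset.sum_le_sum fun k _ => pow_le_pow_left₀ (norm_nonneg _) (hx k) 2
    _ = (C * (‖b‖ * ‖x‖)) ^ 2 * ‖a‖ ^ 2 := by
        rw [EuclideanSpace.norm_sq_eq, Finset.mul_sum]
        exact Finset.sum_congr rfl fun k _ => by ring
    _ = _ := by ring

/-- An entrywise multiplier can increase the operator norm by more than max |φ|; on a rank-one
matrix, which stays rank one after the change of bases, it cannot. -/
theorem norm_bivariateFun_vecMulVec_le (hS : S.IsHermitian) (hT : T.IsHermitian)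
    {φ : ℂ → ℂ → ℂ} {C : ℝ} (hC : 0 ≤ C)
    (hφ : ∀ k l, ‖φ (hS.eigenvalues k) (hT.eigenvalues l)‖ ≤ C)
    (a : EuclideanSpace ℂ p) (b : EuclideanSpace ℂ q) :
    ‖bivariateFun hS hT φ (vecMulVec ⇑a (star ⇑b))‖ ≤ C * (‖a‖ * ‖b‖) := by
  have hU := l2_opNorm_le_one_of_conjTranspose_mul_self (conjTranspose_mul_eigenvectorUnitary hS)
  have hQ := l2_opNorm_le_one_of_conjTranspose_mul_self (conjTranspose_mul_eigenvectorUnitary hT)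
  have hUa := l2_opNorm_mulVec (hS.eigenvectorUnitary : Matrix p p ℂ)ᴴ a
  have hQb := l2_opNorm_mulVec (hT.eigenvectorUnitary : Matrix q q ℂ)ᴴ b
  rw [l2_opNorm_conjTranspose] at hUa hQb
  have hUa := hUa.trans (mul_le_of_le_one_left (norm_nonneg _) hU)
  have hQb := hQb.trans (mul_le_of_le_one_left (norm_nonneg _) hQ)
  rw [bivariateFun]
  refine (l2_opNorm_mul _ _).trans ?_
  rw [l2_opNorm_conjTranspose]
  refine (mul_le_of_le_one_right (norm_nonneg _) hQ).trans ((l2_opNorm_mul _ _).trans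
    ((mul_le_of_le_one_left (norm_nonneg _) hU).trans ?_))
  refine (l2_opNorm_le_of_entry_le hC
    (WithLp.toLp 2 ((hS.eigenvectorUnitary : Matrix p p ℂ)ᴴ *ᵥ ⇑a))
    (WithLp.toLp 2 ((hT.eigenvectorUnitary : Matrix q q ℂ)ᴴ *ᵥ ⇑b)) fun k l => ?_).trans ?_
  · rw [of_apply, mul_vecMulVec, vecMulVec_mul, ← conjTranspose_conjTranspose
      (hT.eigenvectorUnitary : Matrix q q ℂ), ← star_mulVec, vecMulVec_apply, norm_mul, norm_mul,
      Pi.star_apply, norm_star, conjTranspose_conjTranspose]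
    exact mul_le_mul_of_nonneg_right (hφ k l) (by positivity)
  · exact mul_le_mul_of_nonneg_left (mul_le_mul hUa hQb (norm_nonneg _) (norm_nonneg _)) hC

/-- The direction B satisfies SB = λ_k B and BS = λ_l B. If λ_k = λ_l it commutes with S; otherwise
it is a multiple of the commutator BS - SB. -/
theorem fderiv_exp_unitary_single (hS : S.IsHermitian) (k l : p) :
    fderiv ℂ (fun X : Matrix p p ℂ => NormedSpace.exp X) S
      ((hS.eigenvectorUnitary : Matrix p p ℂ) * single k l 1 *
        (hS.eigenvectorUnitary : Matrix p p ℂ)ᴴ) =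
    dslope Complex.exp (hS.eigenvalues k) (hS.eigenvalues l) •
      ((hS.eigenvectorUnitary : Matrix p p ℂ) * single k l 1 *
        (hS.eigenvectorUnitary : Matrix p p ℂ)ᴴ) := by
  set B := (hS.eigenvectorUnitary : Matrix p p ℂ) * single k l 1 *
        (hS.eigenvectorUnitary : Matrix p p ℂ)ᴴ with hB
  have hl (f : ℂ → ℂ) : hermitianFun hS f * B = f (hS.eigenvalues k) • B := by
    have hd : diagonal (fun k => f (hS.eigenvalues k)) * single k l (1 : ℂ) =
        f (hS.eigenvalues k) • single k l 1 := by
      ext i j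
      rw [diagonal_mul, Matrix.smul_apply, smul_eq_mul, single_apply]
      split_ifs with h
      · rw [h.1]
      · simp
    rw [hB, hermitianFun]
    simp only [Matrix.mul_assoc]
    rw [← Matrix.mul_assoc _ᴴ, conjTranspose_mul_eigenvectorUnitary, Matrix.one_mul,
      ← Matrix.mul_assoc (diagonal _), hd, Matrix.smul_mul, Matrix.mul_smul]
  have hr (f : ℂ → ℂ) : B * hermitianFun hS f = f (hS.eigenvalues l) • B := by
    have hd : single k l (1 : ℂ) * diagonal (fun k => f (hS.eigenvalues k)) =
        f (hS.eigenvalues l) • single k l 1 := by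
      ext i j
      rw [mul_diagonal, Matrix.smul_apply, smul_eq_mul, single_apply]
      split_ifs with h
      · rw [h.2, mul_comm]
      · simp
    rw [hB, hermitianFun]
    simp only [Matrix.mul_assoc]
    rw [← Matrix.mul_assoc _ᴴ, conjTranspose_mul_eigenvectorUnitary, Matrix.one_mul,
      ← Matrix.mul_assoc (single _ _ _), hd, Matrix.smul_mul, Matrix.mul_smul]
  have hSB : S * B = (hS.eigenvalues k : ℂ) • B := by
    simpa [hermitianFun_id] using hl id
  have hBS : B * S = (hS.eigenvalues l : ℂ) • B := by
    simpa [hermitianFun_id] using hr id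
  by_cases h : (hS.eigenvalues k : ℂ) = hS.eigenvalues l
  · rw [h, dslope_same, Complex.deriv_exp, fderiv_exp_of_commute, exp_eq_hermitianFun hS, hl, h]
    rw [commute_iff_eq, hSB, hBS, h]
  · have := fderiv_exp_commutator S B
    rw [exp_eq_hermitianFun hS, hl, hr, hSB, hBS, ← sub_smul, ← sub_smul, map_smul] at this
    have hne := sub_ne_zero.2 (Ne.symm h)
    rw [dslope_of_ne _ (Ne.symm h), slope_def_field]
    rw [div_eq_inv_mul, mul_smul, ← this, inv_smul_smul₀ hne]

/-- The Fréchet derivative of the exponential at a Hermitian matrix. -/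
theorem fderiv_exp_eq_bivariateFun (hS : S.IsHermitian) (M : Matrix p p ℂ) :
    fderiv ℂ (fun X : Matrix p p ℂ => NormedSpace.exp X) S M =
      bivariateFun hS hS (dslope Complex.exp) M := by
  set U := (hS.eigenvectorUnitary : Matrix p p ℂ) with hU
  have hM : M = U * (Uᴴ * M * U) * Uᴴ := by
    simp only [Matrix.mul_assoc]
    rw [eigenvectorUnitary_mul_conjTranspose, Matrix.mul_one, ← Matrix.mul_assoc,
      eigenvectorUnitary_mul_conjTranspose, Matrix.one_mul]
  rw [bivariateFun, ← hU]
  conv_lhs => rw [hM]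
  generalize Uᴴ * M * U = N
  conv_lhs => rw [matrix_eq_sum_single N]
  conv_rhs => rw [matrix_eq_sum_single (of _)]
  simp only [Matrix.mul_sum, Matrix.sum_mul, map_sum]
  refine Finset.sum_congr rfl fun k _ => Finset.sum_congr rfl fun l _ => ?_
  have e (c : ℂ) : U * single k l c * Uᴴ = c • (U * single k l 1 * Uᴴ) := by
    rw [← Matrix.smul_mul, ← Matrix.mul_smul, smul_single, smul_eq_mul, mul_one]
  rw [e, map_smul, fderiv_exp_unitary_single, e (of _ k l), smul_smul, of_apply, mul_comm]

/-- The eigenvalues of a compression lie in every convex set that contains the eigenvalues. -/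
theorem eigenvalues_compression_mem {C : Set ℂ} (hC : Convex ℝ C) (hS : S.IsHermitian)
    {V : Matrix p q ℂ} (hV : Vᴴ * V = 1) (hT : T.IsHermitian) (hTS : T = Vᴴ * S * V)
    (hmem : ∀ k, (hS.eigenvalues k : ℂ) ∈ C) (l : q) : (hT.eigenvalues l : ℂ) ∈ C := by
  set U := (hS.eigenvectorUnitary : Matrix p p ℂ) with hU
  set Q := (hT.eigenvectorUnitary : Matrix q q ℂ) with hQ
  -- W has orthonormal columns, so each eigenvalue of T is a convex combination of those of S with
  -- weights |W k l|².
  set W := Uᴴ * V * Q with hW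
  have h1 : Wᴴ * W = 1 := by
    rw [hW, conjTranspose_mul, conjTranspose_mul, conjTranspose_conjTranspose]
    calc _ = Qᴴ * (Vᴴ * (U * Uᴴ) * V) * Q := by simp only [Matrix.mul_assoc]
      _ = _ := by
        rw [eigenvectorUnitary_mul_conjTranspose, Matrix.mul_one, hV, Matrix.mul_one,
          conjTranspose_mul_eigenvectorUnitary]
  have h2 : Wᴴ * diagonal (fun k => (hS.eigenvalues k : ℂ)) * W =
      diagonal (fun l => (hT.eigenvalues l : ℂ)) := by
    have hSU : S = U * diagonal (fun k => (hS.eigenvalues k : ℂ)) * Uᴴ :=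
      (hermitianFun_id hS).symm
    have hTQ : T = Q * diagonal (fun k => (hT.eigenvalues k : ℂ)) * Qᴴ :=
      (hermitianFun_id hT).symm
    rw [hW, conjTranspose_mul, conjTranspose_mul, conjTranspose_conjTranspose]
    calc _ = Qᴴ * (Vᴴ * (U * diagonal (fun k => (hS.eigenvalues k : ℂ)) * Uᴴ) * V) * Q := by
          simp only [Matrix.mul_assoc]
      _ = Qᴴ * T * Q := by rw [← hSU, ← hTS]
      _ = Qᴴ * Q * diagonal (fun k => (hT.eigenvalues k : ℂ)) * (Qᴴ * Q) := by
          conv_lhs => rw [hTQ]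
          simp only [Matrix.mul_assoc]
      _ = _ := by rw [conjTranspose_mul_eigenvectorUnitary, Matrix.mul_one, Matrix.one_mul]
  have h1 := congrFun (congrFun h1 l) l
  have h2 := congrFun (congrFun h2 l) l
  rw [one_apply_eq, mul_apply] at h1
  rw [diagonal_apply_eq, mul_apply] at h2
  simp only [mul_diagonal, conjTranspose_apply] at h1 h2
  have hsq (w : ℂ) : star w * w = ((‖w‖ ^ 2 : ℝ) : ℂ) := by
    rw [Complex.star_def, Complex.conj_mul']; norm_cast
  rw [← h2]
  have h3 : ∑ k, star (W k l) * (hS.eigenvalues k : ℂ) * W k l =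
      ∑ k, (‖W k l‖ ^ 2) • (hS.eigenvalues k : ℂ) := by
    refine Finset.sum_congr rfl fun k _ => ?_
    rw [Complex.real_smul, ← hsq]; ring
  rw [h3]
  refine hC.sum_mem (fun k _ => by positivity) ?_ fun k _ => hmem k
  simp only [hsq] at h1
  exact_mod_cast h1

end Bivariate

/-! ### Divided differences -/

section DividedDifference

/-- Cauchy's integral formula for the divided difference of an entire function. -/
theorem circleIntegral_mul_inv_mul_inv {f : ℂ → ℂ} (hf : Differentiable ℂ f) {c a b : ℂ} {R : ℝ}
    (ha : a ∈ Metric.ball c R) (hb : b ∈ Metric.ball c R) :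
    (2 * Real.pi * Complex.I : ℂ)⁻¹ * ∮ ζ in C(c, R), f ζ * ((ζ - a)⁻¹ * (ζ - b)⁻¹) =
      dslope f a b := by
  have hR : 0 < R := dist_nonneg.trans_lt ha
  have hne {w : ℂ} (hw : w ∈ Metric.ball c R) {ζ : ℂ} (hζ : ζ ∈ Metric.sphere c R) : ζ - w ≠ 0 := by
    rintro h
    rw [sub_eq_zero.1 h, Metric.mem_sphere] at hζ
    exact (Metric.mem_ball.1 hw).ne hζ
  have hcont {w : ℂ} (hw : w ∈ Metric.ball c R) :
      ContinuousOn (fun ζ : ℂ => (ζ - w)⁻¹) (Metric.sphere c R) :=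
    (continuousOn_id.sub continuousOn_const).inv₀ fun ζ hζ => hne hw hζ
  have hd : Differentiable ℂ (dslope f a) := by
    have := (Complex.differentiableOn_dslope (s := Set.univ) (c := a) (f := f)
      Filter.univ_mem).2 hf.differentiableOn
    exact differentiableOn_univ.1 this
  have h1 := hd.differentiableOn.circleIntegral_sub_inv_smul hb
  -- Writing f(ζ) = f(a) + (ζ - a) `dslope f a ζ`, the constant term contributes this integral; for
  -- a ≠ b its two residues cancel.
  have h0 : ∮ ζ in C(c, R), (ζ - a)⁻¹ * (ζ - b)⁻¹ = 0 := by
    by_cases hab : a = b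
    · subst hab
      rw [← circleIntegral.integral_sub_zpow_of_ne (n := -2) (by norm_num) c a R]
      refine circleIntegral.integral_congr hR.le fun ζ _ => ?_
      simp only [zpow_neg]
      rw [← mul_inv, ← sq]
      norm_cast
    · have hab' := sub_ne_zero.2 hab
      have : ∮ ζ in C(c, R), (ζ - a)⁻¹ * (ζ - b)⁻¹ =
          ∮ ζ in C(c, R), (a - b)⁻¹ * ((ζ - a)⁻¹ - (ζ - b)⁻¹) := by
        refine circleIntegral.integral_congr hR.le fun ζ hζ => ?_
        have e1 := hne ha hζ
        have e2 := hne hb hζ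
        field_simp
        ring
      rw [this, circleIntegral.integral_const_mul, circleIntegral.integral_sub
        ((hcont ha).circleIntegrable hR.le) ((hcont hb).circleIntegrable hR.le),
        circleIntegral.integral_sub_inv_of_mem_ball ha,
        circleIntegral.integral_sub_inv_of_mem_ball hb, sub_self, mul_zero]
  have h2 : ∮ ζ in C(c, R), f ζ * ((ζ - a)⁻¹ * (ζ - b)⁻¹) =
      ∮ ζ in C(c, R), ((ζ - b)⁻¹ • dslope f a ζ + f a * ((ζ - a)⁻¹ * (ζ - b)⁻¹)) := by
    refine circleIntegral.integral_congr hR.le fun ζ hζ => ?_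
    have e1 := hne ha hζ
    rw [dslope_of_ne _ (sub_ne_zero.1 e1), slope_def_field, smul_eq_mul]
    field_simp
    ring
  rw [h2, circleIntegral.integral_add, h1, circleIntegral.integral_const_mul, h0, mul_zero,
    add_zero, smul_eq_mul, inv_mul_cancel_left₀ Complex.two_pi_I_ne_zero]
  · exact ((hcont hb).smul hd.continuous.continuousOn).circleIntegrable hR.le
  · exact (continuousOn_const.mul ((hcont ha).mul (hcont hb))).circleIntegrable hR.le

open Polynomial in
/-- The divided difference `(Q x - Q y) / (x - y)` of the antiderivative `Q` of a polynomial `p`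
of degree less than `m`. -/
noncomputable def antiderivDiff (p : ℝ[X]) (m : ℕ) (x y : ℂ) : ℂ :=
  ∑ e ∈ (Finset.range m).sigma fun k => Finset.HasAntidiagonal.antidiagonal k,
    ((p.coeff e.1 / (e.1 + 1) : ℝ) : ℂ) * (x ^ e.2.1 * y ^ e.2.2)

-- Apply the mean value inequality to exp - Q, whose derivative is exp - p; on the diagonal the
-- hypothesis is the bound itself.
open Polynomial in
theorem norm_dslope_exp_sub_antiderivDiff_le {p : ℝ[X]} {m : ℕ} (hp : p ∈ degreeLT ℝ m)
    {lo hi E : ℝ} (hE : ∀ x ∈ Set.Icc lo hi, |Real.exp x - p.eval x| ≤ E) {x y : ℝ}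
    (hx : x ∈ Set.Icc lo hi) (hy : y ∈ Set.Icc lo hi) :
    ‖dslope Complex.exp x y - antiderivDiff p m x y‖ ≤ E := by
  have hpe (s : ℝ) : p.eval s = ∑ k ∈ Finset.range m, p.coeff k * s ^ k := by
    rw [mem_degreeLT] at hp
    by_cases h0 : p = 0
    · simp [h0]
    · exact eval_eq_sum_range' ((natDegree_lt_iff_degree_lt h0).2 hp) s
  have hreal : antiderivDiff p m x y = ((∑ k ∈ Finset.range m, p.coeff k / (k + 1) *
      ∑ i ∈ Finset.range (k + 1), x ^ i * y ^ (k - i) : ℝ) : ℂ) := by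
    rw [antiderivDiff, Finset.sum_sigma, Complex.ofReal_sum]
    refine Finset.sum_congr rfl fun k _ => ?_
    rw [← Finset.Nat.sum_antidiagonal_eq_sum_range_succ (fun i j => x ^ i * y ^ j),
      Finset.mul_sum, Complex.ofReal_sum]
    push_cast
    rfl
  rw [hreal]
  by_cases hxy : x = y
  · subst hxy
    rw [dslope_same, Complex.deriv_exp, ← Complex.ofReal_exp, ← Complex.ofReal_sub,
      Complex.norm_real, Real.norm_eq_abs]
    convert hE x hx using 3
    rw [hpe]
    refine Finset.sum_congr rfl fun k _ => ?_
    have : ∑ i ∈ Finset.range (k + 1), x ^ i * x ^ (k - i) = (k + 1) * x ^ k := by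
      rw [Finset.sum_congr rfl fun i hi => by
        rw [← pow_add, Nat.add_sub_cancel' (Nat.lt_succ_iff.1 (Finset.mem_range.1 hi))]]
      simp
    rw [this]
    have : (k : ℝ) + 1 ≠ 0 := by positivity
    field_simp
  · have hne : y - x ≠ 0 := sub_ne_zero.2 (Ne.symm hxy)
    set Q : ℝ → ℝ := fun s => ∑ k ∈ Finset.range m, p.coeff k / (k + 1) * s ^ (k + 1) with hQ
    have hQd (s : ℝ) : HasDerivAt Q (p.eval s) s := by
      rw [hpe]
      refine HasDerivAt.fun_sum fun k _ => ?_
      refine ((hasDerivAt_pow (k + 1) s).const_mul (p.coeff k / (k + 1))).congr_deriv ?_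
      have : (k : ℝ) + 1 ≠ 0 := by positivity
      push_cast
      field_simp
    have hQs : ∑ k ∈ Finset.range m, p.coeff k / (k + 1) *
        ∑ i ∈ Finset.range (k + 1), x ^ i * y ^ (k - i) = (Q y - Q x) / (y - x) := by
      rw [eq_div_iff hne, hQ, ← Finset.sum_sub_distrib, Finset.sum_mul]
      refine Finset.sum_congr rfl fun k _ => ?_
      have := (Commute.all x y).geom_sum₂_mul (k + 1)
      simp only [Nat.add_sub_cancel] at this
      rw [mul_assoc, ← mul_sub, ← neg_sub x y, mul_neg, this, neg_sub]
    have hmv := (convex_Icc lo hi).norm_image_sub_le_of_norm_hasDerivWithin_le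
      (f := fun s => Real.exp s - Q s) (f' := fun s => Real.exp s - p.eval s)
      (fun s _ => ((Real.hasDerivAt_exp s).sub (hQd s)).hasDerivWithinAt) hE hx hy
    rw [dslope_of_ne _ (by exact_mod_cast Ne.symm hxy), slope_def_field, hQs,
      ← Complex.ofReal_exp, ← Complex.ofReal_exp, ← Complex.ofReal_sub, ← Complex.ofReal_sub,
      ← Complex.ofReal_div, ← Complex.ofReal_sub, Complex.norm_real, ← sub_div, norm_div,
      div_le_iff₀ (norm_pos_iff.2 hne)]
    rwa [sub_sub_sub_comm]

end DividedDifference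

/-! ### Error of the Arnoldi approximation -/

section ArnoldiError

open Matrix

/-- Diagonalizing both resolvents reduces each pair of eigenvalues to the scalar Cauchy formula. -/
theorem circleIntegral_resolvent_eq_bivariateFun {p q : Type*} [Fintype p] [DecidableEq p]
    [Fintype q] [DecidableEq q] {S : Matrix p p ℂ} {T : Matrix q q ℂ} (hS : S.IsHermitian)
    (hT : T.IsHermitian) {f : ℂ → ℂ} (hf : Differentiable ℂ f) {c : ℂ} {R : ℝ}
    (hSR : ∀ k, (hS.eigenvalues k : ℂ) ∈ Metric.ball c R)
    (hTR : ∀ k, (hT.eigenvalues k : ℂ) ∈ Metric.ball c R) (M : Matrix p q ℂ) (i : p) (j : q) :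
    (2 * Real.pi * Complex.I : ℂ)⁻¹ * ∮ ζ in C(c, R),
      f ζ * ((ζ • (1 : Matrix p p ℂ) - S)⁻¹ * M * (ζ • (1 : Matrix q q ℂ) - T)⁻¹) i j =
    bivariateFun hS hT (dslope f) M i j := by
  -- The row index `i` supplies an eigenvalue inside the disc, so empty bases need no separate
  -- treatment.
  have hR : 0 < R := dist_nonneg.trans_lt (hSR i)
  have hne {w : ℂ} (hw : w ∈ Metric.ball c R) {ζ : ℂ} (hζ : ζ ∈ Metric.sphere c R) : ζ ≠ w := by
    rintro rfl
    exact (Metric.mem_ball.1 hw).ne hζ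
  set U := (hS.eigenvectorUnitary : Matrix p p ℂ) with hU
  set Q := (hT.eigenvectorUnitary : Matrix q q ℂ) with hQ
  have hentry (φ : ℂ → ℂ → ℂ) : bivariateFun hS hT φ M i j = ∑ l, ∑ k,
      (U i k * (Uᴴ * M * Q) k l * Qᴴ l j) * φ (hS.eigenvalues k) (hT.eigenvalues l) := by
    rw [bivariateFun, mul_apply]
    refine Finset.sum_congr rfl fun l _ => ?_
    rw [mul_apply, Finset.sum_mul]
    refine Finset.sum_congr rfl fun k _ => ?_
    rw [of_apply]
    ring
  have hint : ∮ ζ in C(c, R),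
      f ζ * ((ζ • (1 : Matrix p p ℂ) - S)⁻¹ * M * (ζ • (1 : Matrix q q ℂ) - T)⁻¹) i j =
      ∮ ζ in C(c, R), ∑ l, ∑ k, (U i k * (Uᴴ * M * Q) k l * Qᴴ l j) *
        (f ζ * ((ζ - hS.eigenvalues k)⁻¹ * (ζ - hT.eigenvalues l)⁻¹)) := by
    refine circleIntegral.integral_congr hR.le fun ζ hζ => ?_
    rw [inv_smul_one_sub hS fun k => hne (hSR k) hζ, inv_smul_one_sub hT fun k => hne (hTR k) hζ,
      ← bivariateFun_mul, hentry, Finset.mul_sum]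
    refine Finset.sum_congr rfl fun l _ => ?_
    rw [Finset.mul_sum]
    exact Finset.sum_congr rfl fun k _ => by ring
  have hci (k : p) (l : q) : CircleIntegrable (fun ζ => (U i k * (Uᴴ * M * Q) k l * Qᴴ l j) *
        (f ζ * ((ζ - hS.eigenvalues k)⁻¹ * (ζ - hT.eigenvalues l)⁻¹))) c R := by
    refine ContinuousOn.circleIntegrable hR.le (continuousOn_const.mul
      (hf.continuous.continuousOn.mul (ContinuousOn.mul ?_ ?_)))
    · exact (continuousOn_id.sub continuousOn_const).inv₀ fun ζ hζ =>
        sub_ne_zero.2 (hne (hSR k) hζ)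
    · exact (continuousOn_id.sub continuousOn_const).inv₀ fun ζ hζ =>
        sub_ne_zero.2 (hne (hTR l) hζ)
  rw [hint, hentry, circleIntegral.integral_fun_sum fun l _ =>
    CircleIntegrable.fun_sum _ fun k _ => hci k l, Finset.mul_sum]
  refine Finset.sum_congr rfl fun l _ => ?_
  rw [circleIntegral.integral_fun_sum fun k _ => hci k l, Finset.mul_sum]
  refine Finset.sum_congr rfl fun k _ => ?_
  rw [circleIntegral.integral_const_mul, mul_left_comm,
    circleIntegral_mul_inv_mul_inv hf (hSR k) (hTR l)]

variable {n : ℕ} {S : Matrix (Fin n) (Fin n) ℂ}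

theorem isHermitian_arnoldiHess (hS : S.IsHermitian) (b : EuclideanSpace ℂ (Fin n)) (m : ℕ) :
    (arnoldiHess S b m).IsHermitian := by
  rw [arnoldiHess_eq]
  exact isHermitian_conjTranspose_mul_mul _ hS

theorem arnoldiCore_eq_bivariateFun (y z : EuclideanSpace ℂ (Fin n)) (m : ℕ)
    (hG : (arnoldiHess S y m).IsHermitian) (hH : ((arnoldiHess Sᴴ z m)ᴴ).IsHermitian)
    {f : ℂ → ℂ} (hf : Differentiable ℂ f) {c : ℂ} {R : ℝ}
    (hGR : ∀ k, (hG.eigenvalues k : ℂ) ∈ Metric.ball c R)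
    (hHR : ∀ k, (hH.eigenvalues k : ℂ) ∈ Metric.ball c R) :
    arnoldiCore f S y z m c R = bivariateFun hG hH (dslope f)
      (vecMulVec ((arnoldiBasis S y m)ᴴ *ᵥ ⇑y) (star ((arnoldiBasis Sᴴ z m)ᴴ *ᵥ ⇑z))) := by
  ext i j
  rw [← circleIntegral_resolvent_eq_bivariateFun hG hH hf hGR hHR, ← smul_vecMulVec_arnoldiE1]
  simp only [arnoldiCore, of_apply, Matrix.mul_smul, Matrix.smul_mul, Matrix.smul_apply,
    smul_eq_mul, mul_assoc]

theorem arnoldi_bivariateFun_exact (hS : S.IsHermitian) (y z : EuclideanSpace ℂ (Fin n)) (m : ℕ)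
    (hG : (arnoldiHess S y m).IsHermitian) (hH : ((arnoldiHess Sᴴ z m)ᴴ).IsHermitian)
    (p : Polynomial ℝ) :
    arnoldiBasis S y m * bivariateFun hG hH (antiderivDiff p m)
      (vecMulVec ((arnoldiBasis S y m)ᴴ *ᵥ ⇑y) (star ((arnoldiBasis Sᴴ z m)ᴴ *ᵥ ⇑z))) *
      (arnoldiBasis Sᴴ z m)ᴴ =
    bivariateFun hS hS (antiderivDiff p m) (vecMulVec ⇑y (star ⇑z)) := by
  unfold antiderivDiff
  rw [bivariateFun_sum, bivariateFun_sum, Matrix.mul_sum, Matrix.sum_mul]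
  refine Finset.sum_congr rfl fun e he => ?_
  have he1 := Finset.mem_range.1 (Finset.mem_sigma.1 he).1
  have he2 := Finset.HasAntidiagonal.mem_antidiagonal.1 (Finset.mem_sigma.1 he).2
  rw [bivariateFun_mul hG hH (fun x => x ^ e.2.1) (fun y => y ^ e.2.2),
    bivariateFun_mul hS hS (fun x => x ^ e.2.1) (fun y => y ^ e.2.2)]
  simp only [hermitianFun_pow]
  rw [Matrix.mul_smul, Matrix.smul_mul, arnoldi_exact S y z m (by omega) (by omega)]

theorem norm_conjTranspose_arnoldiBasis_mulVec_le (S : Matrix (Fin n) (Fin n) ℂ)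
    (y : EuclideanSpace ℂ (Fin n)) (m : ℕ) :
    ‖WithLp.toLp 2 ((arnoldiBasis S y m)ᴴ *ᵥ ⇑y)‖ ≤ ‖y‖ := by
  have h := l2_opNorm_mulVec (arnoldiBasis S y m)ᴴ y
  rw [l2_opNorm_conjTranspose] at h
  exact h.trans (mul_le_of_le_one_left (norm_nonneg _)
    (l2_opNorm_le_one_of_conjTranspose_mul_self (arnoldiBasis_conjTranspose_mul_self S y m)))

/-- The Arnoldi error for the Fréchet derivative of the exponential is at most twice the error of
a polynomial approximation of the exponential. -/
theorem norm_expFrechet_sub_arnoldiFrechet_le (hS : S.IsHermitian)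
    (y z : EuclideanSpace ℂ (Fin n)) (m : ℕ) {c : ℂ} {R : ℝ}
    (hR : ∀ k, (hS.eigenvalues k : ℂ) ∈ Metric.ball c R) {lo hi : ℝ}
    (hI : ∀ k, hS.eigenvalues k ∈ Set.Icc lo hi) {p : Polynomial ℝ}
    (hp : p ∈ Polynomial.degreeLT ℝ m) {E : ℝ} (hE0 : 0 ≤ E)
    (hE : ∀ x ∈ Set.Icc lo hi, |Real.exp x - p.eval x| ≤ E) :
    ‖expFrechet S (vecMulVec ⇑y (star ⇑z)) - arnoldiFrechet Complex.exp S y z m c R‖ ≤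
      2 * E * (‖y‖ * ‖z‖) := by
  have hG := isHermitian_arnoldiHess hS y m
  have hH := (isHermitian_arnoldiHess hS.conjTranspose z m).conjTranspose
  have hVG := arnoldiBasis_conjTranspose_mul_self S y m
  have hVH := arnoldiBasis_conjTranspose_mul_self Sᴴ z m
  have hGC {C : Set ℂ} (hC : Convex ℝ C) (h : ∀ k, (hS.eigenvalues k : ℂ) ∈ C) (k) :
      (hG.eigenvalues k : ℂ) ∈ C :=
    eigenvalues_compression_mem hC hS hVG hG (arnoldiHess_eq S y m) h k
  have hHC {C : Set ℂ} (hC : Convex ℝ C) (h : ∀ k, (hS.eigenvalues k : ℂ) ∈ C) (k) :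
      (hH.eigenvalues k : ℂ) ∈ C := by
    refine eigenvalues_compression_mem hC hS hVH hH ?_ h k
    rw [arnoldiHess_eq, conjTranspose_mul, conjTranspose_mul, conjTranspose_conjTranspose,
      conjTranspose_conjTranspose, Matrix.mul_assoc]
  -- The real interval is recast as a strip so that the same convexity lemma serves both it and the
  -- contour disc.
  have hIC : Convex ℝ (Complex.re ⁻¹' Set.Icc lo hi) :=
    (convex_Icc lo hi).linear_preimage Complex.reLm
  rw [expFrechet, fderiv_exp_eq_bivariateFun hS, arnoldiFrechet,
    arnoldiCore_eq_bivariateFun y z m hG hH Complex.differentiable_exp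
      (hGC (convex_ball c R) hR) (hHC (convex_ball c R) hR)]
  set Y := vecMulVec ⇑y (star ⇑z) with hY
  set M := vecMulVec ((arnoldiBasis S y m)ᴴ *ᵥ ⇑y) (star ((arnoldiBasis Sᴴ z m)ᴴ *ᵥ ⇑z)) with hM
  -- Exactness lets the polynomial part be subtracted from both terms at no cost.
  have hsplit : bivariateFun hS hS (dslope Complex.exp) Y -
      arnoldiBasis S y m * bivariateFun hG hH (dslope Complex.exp) M * (arnoldiBasis Sᴴ z m)ᴴ =
      bivariateFun hS hS (fun u v => dslope Complex.exp u v - antiderivDiff p m u v) Y -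
      arnoldiBasis S y m *
        bivariateFun hG hH (fun u v => dslope Complex.exp u v - antiderivDiff p m u v) M *
        (arnoldiBasis Sᴴ z m)ᴴ := by
    rw [← bivariateFun_sub, ← bivariateFun_sub, Matrix.mul_sub, Matrix.sub_mul,
      arnoldi_bivariateFun_exact hS]
    abel
  have h1 : ‖bivariateFun hS hS
      (fun u v => dslope Complex.exp u v - antiderivDiff p m u v) Y‖ ≤ E * (‖y‖ * ‖z‖) :=
    norm_bivariateFun_vecMulVec_le hS hS hE0
      (fun k l => norm_dslope_exp_sub_antiderivDiff_le hp hE (hI k) (hI l)) y z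
  have h2 : ‖bivariateFun hG hH
      (fun u v => dslope Complex.exp u v - antiderivDiff p m u v) M‖ ≤ E * (‖y‖ * ‖z‖) := by
    refine (norm_bivariateFun_vecMulVec_le hG hH hE0
      (fun k l => norm_dslope_exp_sub_antiderivDiff_le hp hE (hGC hIC hI k) (hHC hIC hI l))
      (WithLp.toLp 2 ((arnoldiBasis S y m)ᴴ *ᵥ ⇑y))
      (WithLp.toLp 2 ((arnoldiBasis Sᴴ z m)ᴴ *ᵥ ⇑z))).trans ?_
    exact mul_le_mul_of_nonneg_left (mul_le_mul (norm_conjTranspose_arnoldiBasis_mulVec_le S y m)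
      (norm_conjTranspose_arnoldiBasis_mulVec_le Sᴴ z m) (norm_nonneg _) (norm_nonneg _)) hE0
  rw [hsplit]
  refine (norm_sub_le _ _).trans ?_
  have h3 := (l2_opNorm_mul (arnoldiBasis S y m * bivariateFun hG hH
    (fun u v => dslope Complex.exp u v - antiderivDiff p m u v) M) (arnoldiBasis Sᴴ z m)ᴴ)
  rw [l2_opNorm_conjTranspose] at h3
  have h4 := h3.trans ((mul_le_of_le_one_right (norm_nonneg _)
    (l2_opNorm_le_one_of_conjTranspose_mul_self hVH)).trans ((l2_opNorm_mul _ _).trans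
      (mul_le_of_le_one_left (norm_nonneg _) (l2_opNorm_le_one_of_conjTranspose_mul_self hVG))))
  linarith

end ArnoldiError

/-! ### The two error bounds -/

theorem mainTheorem1 {n : ℕ} (A : Matrix (Fin n) (Fin n) ℂ) (hA : A.IsHermitian)
    (ρ t : ℝ) (hρ : 0 < ρ) (ht : 0 < t)
    (hspec : spectrum ℝ A ⊆ Set.Icc (-4 * ρ) 0)
    (y z : EuclideanSpace ℂ (Fin n)) (m : ℕ)
    (c : ℂ) (R : ℝ) (hΓ : spectrum ℂ ((t : ℂ) • A) ⊆ Metric.ball c R) :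
    (Real.sqrt (4 * ρ * t) ≤ (m : ℝ) → (m : ℝ) ≤ 2 * ρ * t →
      ‖expFrechet ((t : ℂ) • A) (Matrix.vecMulVec y (star z)) -
          arnoldiFrechet Complex.exp ((t : ℂ) • A) y z m c R‖ ≤
        10 * ((4 * ρ * t) ^ 2 / (m : ℝ) ^ 2) * Real.exp (-((m : ℝ) ^ 2 / (5 * ρ * t))) *
          ‖y‖ * ‖z‖) ∧
    (2 * ρ * t ≤ (m : ℝ) →
      ‖expFrechet ((t : ℂ) • A) (Matrix.vecMulVec y (star z)) -
          arnoldiFrechet Complex.exp ((t : ℂ) • A) y z m c R‖ ≤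
        40 / (ρ * t) * Real.exp (-(ρ * t)) * (Real.exp 1 * ρ * t / (m : ℝ)) ^ m *
          ‖y‖ * ‖z‖) := by
  have hS : ((t : ℂ) • A).IsHermitian := by
    rw [Matrix.IsHermitian, Matrix.conjTranspose_smul, hA.eq]
    simp
  have ha : 0 < 2 * ρ * t := by positivity
  have hR (k) : (hS.eigenvalues k : ℂ) ∈ Metric.ball c R :=
    hΓ ((spectrum.algebraMap_mem_iff ℂ).2 (hS.eigenvalues_mem_spectrum_real k))
  have hI (k) : hS.eigenvalues k ∈ Set.Icc (-(2 * (2 * ρ * t))) 0 := by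
    have h1 := hS.eigenvalues_mem_spectrum_real k
    have h2 : (t : ℂ) • A = (Units.mk0 t ht.ne') • A := by
      ext i j
      simp [Units.smul_def]
    have h3 : (Units.mk0 t ht.ne') • (t⁻¹ * hS.eigenvalues k) = hS.eigenvalues k := by
      rw [Units.smul_def, smul_eq_mul, Units.val_mk0, mul_inv_cancel_left₀ ht.ne']
    have h4 : t⁻¹ * hS.eigenvalues k ∈ spectrum ℝ A := by
      refine spectrum.smul_mem_smul_iff.1 (?_ : (Units.mk0 t ht.ne') • _ ∈ spectrum ℝ
        ((Units.mk0 t ht.ne') • A))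
      rw [h3, ← h2]
      exact h1
    obtain ⟨h5, h6⟩ := hspec h4
    rw [inv_mul_eq_div] at h5 h6
    rw [le_div_iff₀ ht] at h5
    rw [div_le_iff₀ ht] at h6
    constructor <;> linarith
  have key (σ : ℝ) : ‖expFrechet ((t : ℂ) • A) (Matrix.vecMulVec y (star z)) -
      arnoldiFrechet Complex.exp ((t : ℂ) • A) y z m c R‖ ≤
      8 * Real.exp (2 * ρ * t * (Real.cosh σ - 1) - m * σ) * (‖y‖ * ‖z‖) := by
    obtain ⟨p, hp, hpE⟩ := exists_poly_approx_exp m ha σ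
    refine (norm_expFrechet_sub_arnoldiFrechet_le hS y z m hR hI hp (by positivity) hpE).trans
      (le_of_eq ?_)
    ring
  have hyz : 0 ≤ ‖y‖ * ‖z‖ := by positivity
  -- In each branch the σ of `key _` is fixed by unification with the scalar estimate.
  refine ⟨fun h1 h2 => ?_, fun h => ?_⟩
  · have hm : (0 : ℝ) < m := (Real.sqrt_pos.2 (by positivity)).trans_le h1
    refine (key _).trans ((mul_le_mul_of_nonneg_right (exp_bound_of_le hm h2) hyz).trans
      (le_of_eq ?_))
    rw [show 2 * (m : ℝ) ^ 2 / (5 * (2 * ρ * t)) = (m : ℝ) ^ 2 / (5 * ρ * t) by field_simp]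
    ring
  · refine (key _).trans ((mul_le_mul_of_nonneg_right (exp_bound_of_ge ha h) hyz).trans
      (le_of_eq ?_))
    rw [show 80 / (2 * ρ * t) = 40 / (ρ * t) by field_simp; norm_num,
      show 2 * ρ * t / 2 = ρ * t by ring, ← mul_assoc (Real.exp 1)]
    ring
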